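/- **Setting.** There are $n$ varieties $N=\{1,\dots,n\}$ with $\Omega_j$ units of variety $j$; packages are the subsets $S\in 2^N$. Buyers are $l\in[L]$, where $[m]:=\{1,\dots,m\}$; buyer $l$ consists of $\bar Q^l$ unit-demand agents with values $v^l(S,q)\in\mathbb Z_+$ ($v^l(S,q)=0$ for $q>\bar Q^l$), and $\bar Q=\max_l\bar Q^l$. A cost function graph is a directed graph on $2^N$ in which every arc $(T,S)$ satisfies $S\subsetneq T$ and every $S$ is connected by a directed path to $\{j\}$ for every $j\in S$. Let $R_0^+(S)$ be the set of packages reachable from $S$ by directed paths (including $S$), and $R^-(S)$ the set of packages $S'\ne S$ from which $S$ is reachable, $R_0^-(S)=R^-(S)\cup\{S\}$. Incremental costs are $\Delta c(S,r)\in\mathbb Z\cup\{\infty\}$ ($r\ge1$), nondecreasing in $r$, with $\Delta c(\{j\},r)=\infty$ for $r>\Omega_j$, finite only for finitely many steps $r$; $\bar R$ is the largest $r$ with $\Delta c(S,r)<\infty$ for some $S$ ($\bar R=0$ if there is none). The cost $\sum_S\sum_{r\le r_S}\Delta c(S,r)$, with $r_S=\sum_{S'\in R_0^-(S)}k_{S'}$,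 is nonnegative for every $k\in\mathbb Z_+^{2^N}$ with $\sum_{S\ni j}k_S\le\Omega_j$ for all $j$. For $Y\in\mathbb R^{2^N}$ define $\Phi Y=k$ recursively by $k_S=Y_S-\sum_{S'\in R^-(S)}k_{S'}$; this is linear, and $\Phi$ also denotes its matrix. Consider the linear program (with $\infty\cdot0=0$, $S\in2^N$, $q\in[\bar Q]$, $l\in[L]$, $r\in[\bar R]$) $$\text{(SWLP)}\quad \max_{x,y\ge0}\ \sum_{S,q,l}v^l(S,q)x(S,q,l)-\sum_{S,r}\Delta c(S,r)y(S,r)$$ subject to $\sum_S x(S,q,l)\le1$, $\ \sum_{q,l}x(S,q,l)\le(\Phi Y)_S$ where $Y_T=\sum_r y(T,r)$, and $y(S,r)\le1$; and its dual $$\text{(DSWLP)}\quad \min_{b,p,d\ge0}\ \sum_{q,l}b(q,l)+\sum_{S,r}d(S,r)$$ subject to $b(q,l)+p(S)\ge v^l(S,q)$ and $d(S,r)-(\Phi^{\mathsf T}p)_S\ge-\Delta c(S,r)$. For a solution $(x,y)$ of SWLP let $\tilde r_S$ be the largest $r$ with $y(S,r)>0$ ($\tilde r_S=0$ if there is none).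 Say that the steps of $S$ are *allocated in order* if $y(S,r')>0$ implies $y(S,r)=1$ for all $r<r'$ (for integral $y$: $y(S,r)=1$ for $r\le\tilde r_S$ and $y(S,r)=0$ for $r>\tilde r_S$). **Proposition.** Let $(x,y)$ be an optimal solution of SWLP and $(b,p,d)$ an optimal solution of DSWLP. 1. For every $r\in[\bar R]$ and every $S\in2^N$, $\displaystyle p(S)\le\sum_{S'\in R_0^+(S)}\Delta c(S',r)+\sum_{S'\in R_0^+(S)}d(S',r).$ 2. For every $S\in 2^N$ whose steps are allocated in order and every $r\in[\bar R]$ with $r\le\tilde r_S$, $\displaystyle p(S)=\sum_{S'\in R_0^+(S)}\Delta c(S',r)+\sum_{S'\in R_0^+(S)}d(S',r)$ (in particular the right-hand side is finite). 3. The pricing function that charges every agent (the seller or a buyer) $p(k)=\sum_S k_S\,p(S)$ for a package multiset $k$ is uniform (an additional copy of $S$ has the same price whatever else is traded), anonymous (the price of $k$ does not depend on the agent), and package-linear (the price of $k$ is $\sum_S k_S$ times the price of a single copy of $S$). -/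

import Mathlib

open Finset

/-- A package is a subset of the set of varieties `{1, …, n}`. -/
abbrev Package (n : ℕ) := Finset (Fin n)

/-- A package multiset: a multiplicity for every package. -/
abbrev PackageMultiset (n : ℕ) := Package n → ℕ

/-- A cost function graph: a directed graph on the packages, each arc of which leads from a package
to a proper subset, and in which every package is connected by a directed path to every single
variety that it contains. -/
structure CostFunctionGraph (n : ℕ) where
  Arc : Package n → Package n → Prop
  ssubset_of_arc : ∀ T S, Arc T S → S ⊂ T
  path_to_variety : ∀ (S : Package n) (j : Fin n), j ∈ S → Relation.ReflTransGen Arc S {j}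

namespace CostFunctionGraph

variable {n : ℕ} (G : CostFunctionGraph n)

/-- `T` is (cost-)connected to `S`: there is a directed path, possibly of length `0`. -/
def Connected (T S : Package n) : Prop := Relation.ReflTransGen G.Arc T S

theorem Connected.subset {G : CostFunctionGraph n} {T S : Package n} (h : G.Connected T S) :
    S ⊆ T := by
  induction h with
  | refl => exact Finset.Subset.refl _
  | tail _ hbc ih => exact (G.ssubset_of_arc _ _ hbc).subset.trans ih

open Classical in
/-- The successors of `S`, including `S`. -/
noncomputable def successors (S : Package n) : Finset (Package n) :=
  univ.filter fun S' => G.Connected S S'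

open Classical in
/-- The predecessors of `S`, including `S`. -/
noncomputable def predecessors (S : Package n) : Finset (Package n) :=
  univ.filter fun S' => G.Connected S' S

open Classical in
/-- The strict predecessors of `S`. -/
noncomputable def strictPredecessors (S : Package n) : Finset (Package n) :=
  univ.filter fun S' => G.Connected S' S ∧ S' ≠ S

theorem card_compl_lt {S S' : Package n} (h : S' ∈ G.strictPredecessors S) :
    S'ᶜ.card < Sᶜ.card := by
  classical
  simp only [strictPredecessors, mem_filter, mem_univ, true_and] at h
  exact Finset.card_lt_card
    (Finset.compl_ssubset_compl.2 (h.1.subset.ssubset_of_ne h.2.symm))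

/-- The characteristic function of the graph, computed from the sources downwards by
`k_S = Y_S - ∑ k_{S'}`, the sum being over the strict predecessors `S'` of `S`. Here `Y_S` is the
total quantity that is allocated on the incremental cost function of `S`. -/
noncomputable def charFun (Y : Package n → ℝ) (S : Package n) : ℝ :=
  Y S - ∑ S' ∈ (G.strictPredecessors S).attach, charFun Y S'.1
termination_by Sᶜ.card
decreasing_by exact G.card_compl_lt S'.2

theorem charFun_eq (Y : Package n → ℝ) (S : Package n) :
    G.charFun Y S = Y S - ∑ S' ∈ G.strictPredecessors S, G.charFun Y S' := by
  rw [charFun, Finset.sum_attach (G.strictPredecessors S) (fun S' => G.charFun Y S')]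

open Classical in
/-- The matrix of the characteristic function. -/
noncomputable def charMatrix : Matrix (Package n) (Package n) ℝ :=
  Matrix.of fun S T => G.charFun (Pi.single T 1) S

theorem charFun_eq_mulVec (Y : Package n → ℝ) : G.charFun Y = G.charMatrix.mulVec Y := by
  classical
  have key : ∀ (m : ℕ) (S : Package n), Sᶜ.card = m →
      G.charFun Y S = ∑ T, G.charFun (Pi.single T 1) S * Y T := by
    intro m
    induction m using Nat.strong_induction_on with
    | _ m ih =>
      intro S hS
      have h1 : ∀ S' ∈ G.strictPredecessors S,
          G.charFun Y S' = ∑ T, G.charFun (Pi.single T 1) S' * Y T := fun S' hS' =>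
        ih _ (hS ▸ G.card_compl_lt hS') S' rfl
      rw [charFun_eq, Finset.sum_congr rfl h1, Finset.sum_comm]
      have h2 : ∀ T, G.charFun (Pi.single T 1) S * Y T
          = (Pi.single T 1 : Package n → ℝ) S * Y T
            - ∑ S' ∈ G.strictPredecessors S, G.charFun (Pi.single T 1) S' * Y T := by
        intro T
        rw [charFun_eq, sub_mul, Finset.sum_mul]
      rw [Finset.sum_congr rfl (fun T _ => h2 T), Finset.sum_sub_distrib]
      congr 1
      simp [Pi.single_apply]
  funext S
  rw [key _ S rfl]
  simp only [charMatrix, Matrix.mulVec, dotProduct, Matrix.of_apply]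

/-- The characteristic function dual: the transposed matrix applied to package prices. -/
noncomputable def charDual (p : Package n → ℝ) : Package n → ℝ :=
  G.charMatrix.transpose.mulVec p

end CostFunctionGraph

/-- A market with packaging costs: `n` varieties with `Ω j` units of variety `j`, `L` buyers, each
of whom consists of finitely many unit-demand agents, and a seller whose costs are given by a cost
function graph and by incremental costs with values in `ℤ ∪ {∞}`. Steps `r` and unit-demand agents
`q` are numbered from `1`. -/
structure Market (n L : ℕ) where
  Ω : Fin n → ℕ
  /-- the number of unit-demand agents of a buyer -/
  numAgents : Fin L → ℕ
  /-- `v l S q` is the value of package `S` for the `q`-th unit-demand agent of buyer `l` -/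
  v : Fin L → Package n → ℕ → ℕ
  v_eq_zero : ∀ l S q, numAgents l < q → v l S q = 0
  G : CostFunctionGraph n
  /-- `Δc S r` is the height of step `r` of the incremental cost function of `S` -/
  Δc : Package n → ℕ → WithTop ℤ
  Δc_singleton : ∀ j r, Ω j < r → Δc {j} r = ⊤
  Δc_mono : ∀ S r, 1 ≤ r → Δc S r ≤ Δc S (r + 1)
  finitely_many_steps : ∃ R, ∀ S r, R < r → Δc S r = ⊤
  /-- the cost of every feasible package multiset is non-negative -/
  cost_nonneg : ∀ k : PackageMultiset n, (∀ j, ∑ S, (if j ∈ S then k S else 0) ≤ Ω j) →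
    0 ≤ ∑ S, ∑ r ∈ Icc 1 (∑ S' ∈ G.predecessors S, k S'), Δc S r

/-- The inclusion of `ℤ ∪ {∞}` in the extended real numbers. -/
noncomputable def costToEReal (c : WithTop ℤ) : EReal :=
  WithTop.recTopCoe (⊤ : EReal) (fun z : ℤ => ((z : ℝ) : EReal)) c

namespace Market

variable {n L : ℕ} (M : Market n L)

/-- The largest number of unit-demand agents of a buyer. -/
def maxAgents : ℕ := univ.sup M.numAgents

/-- The last step at which some incremental cost function is finite (`0` if there is none). -/
noncomputable def maxStep : ℕ := sSup {r | 1 ≤ r ∧ ∃ S, M.Δc S r ≠ ⊤}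

/-- The indices `1, …, maxAgents`. -/
abbrev Agent := {q : ℕ // q ∈ Icc 1 M.maxAgents}

/-- The indices `1, …, maxStep`. -/
abbrev Step := {r : ℕ // r ∈ Icc 1 M.maxStep}

/-- Incremental costs as extended real numbers. -/
noncomputable def incCost (S : Package n) (r : ℕ) : EReal := costToEReal (M.Δc S r)

/-- Feasibility in the linear programming relaxation of welfare maximization. -/
structure PrimalFeasible (x : Package n → M.Agent → Fin L → ℝ) (y : Package n → M.Step → ℝ) :
    Prop where
  agent : ∀ (q : M.Agent) (l : Fin L), ∑ S, x S q l ≤ 1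
  supply : ∀ S, (∑ q : M.Agent, ∑ l, x S q l) - M.G.charFun (fun T => ∑ r : M.Step, y T r) S ≤ 0
  y_le_one : ∀ S r, y S r ≤ 1
  x_nonneg : ∀ S q l, 0 ≤ x S q l
  y_nonneg : ∀ S r, 0 ≤ y S r

/-- The objective of the relaxation, with `∞ · 0 = 0` and `∞ · t = ∞` for `t > 0`. -/
noncomputable def primalValue (x : Package n → M.Agent → Fin L → ℝ)
    (y : Package n → M.Step → ℝ) : EReal :=
  ((∑ S, ∑ q : M.Agent, ∑ l, (M.v l S q : ℝ) * x S q l : ℝ) : EReal)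
    - ∑ S, ∑ r : M.Step, M.incCost S r * ((y S r : ℝ) : EReal)

/-- An optimal solution of the relaxation. -/
structure PrimalOptimal (x : Package n → M.Agent → Fin L → ℝ) (y : Package n → M.Step → ℝ) :
    Prop where
  feasible : M.PrimalFeasible x y
  optimal : ∀ x' y', M.PrimalFeasible x' y' → M.primalValue x' y' ≤ M.primalValue x y

/-- Feasibility in the dual linear program. -/
structure DualFeasible (b : M.Agent → Fin L → ℝ) (p : Package n → ℝ)
    (d : Package n → M.Step → ℝ) : Prop where
  buyer : ∀ (S : Package n) (q : M.Agent) (l : Fin L), (M.v l S q : ℝ) ≤ b q l + p S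
  seller : ∀ (S : Package n) (r : M.Step), -M.incCost S r ≤ ((d S r - M.G.charDual p S : ℝ) : EReal)
  b_nonneg : ∀ q l, 0 ≤ b q l
  d_nonneg : ∀ S r, 0 ≤ d S r
  p_nonneg : ∀ S, 0 ≤ p S

/-- The objective of the dual linear program. -/
noncomputable def dualValue (b : M.Agent → Fin L → ℝ) (d : Package n → M.Step → ℝ) : ℝ :=
  (∑ q, ∑ l, b q l) + ∑ S, ∑ r, d S r

/-- An optimal solution of the dual linear program. -/
structure DualOptimal (b : M.Agent → Fin L → ℝ) (p : Package n → ℝ)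
    (d : Package n → M.Step → ℝ) : Prop where
  feasible : M.DualFeasible b p d
  optimal : ∀ b' p' d', M.DualFeasible b' p' d' → M.dualValue b d ≤ M.dualValue b' d'

open Classical in
/-- The last step of the incremental cost function of `S` on which a positive quantity is
allocated, and `0` if nothing is allocated. -/
noncomputable def lastStep (y : Package n → M.Step → ℝ) (S : Package n) : ℕ :=
  (univ.filter fun r => 0 < y S r).sup fun r => (r : ℕ)

/-- The steps of the incremental cost function of `S` are allocated in order: a step receives
something only if all earlier steps are allocated completely. For integral `y` this says that
`y S r = 1` up to some step and `y S r = 0` thereafter. -/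
def AllocatedInOrder (y : Package n → M.Step → ℝ) (S : Package n) : Prop :=
  ∀ r r' : M.Step, r < r' → 0 < y S r' → y S r = 1

end Market

/-- The price `p(k) = ∑ k_S p(S)` at which agent `a` trades the package multiset `k`; agent `0` is
the seller and `1, …, L` are the buyers. -/
noncomputable def priceOf {n : ℕ} (L : ℕ) (p : Package n → ℝ) (_a : Fin (L + 1))
    (k : PackageMultiset n) : ℝ :=
  ∑ S, (k S : ℝ) * p S

open Classical in
/-- The package multiset that consists of one copy of `S`. -/
noncomputable def singlePackage {n : ℕ} (S : Package n) : PackageMultiset n := Pi.single S 1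

/-- Every agent's price of a multiset is the sum of that agent's prices of its packages. -/
def IsPackageLinear {n L : ℕ} (P : Fin (L + 1) → PackageMultiset n → ℝ) : Prop :=
  ∀ a k, P a k = ∑ S, (k S : ℝ) * P a (singlePackage S)

/-- Prices do not depend on who trades. -/
def IsAnonymous {n L : ℕ} (P : Fin (L + 1) → PackageMultiset n → ℝ) : Prop :=
  ∀ a a' k, P a k = P a' k

/-- All copies of a package have the same price: what an agent pays for one more copy of `S` does
not depend on what else the agent trades. -/
def IsUniform {n L : ℕ} (P : Fin (L + 1) → PackageMultiset n → ℝ) : Prop :=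
  ∀ a S k k', P a (k + singlePackage S) - P a k = P a (k' + singlePackage S) - P a k'

section LinearProgramming

/-!
The matrix of the characteristic function is inverse to the zeta matrix of reachability, so `p S` is
the sum of `(Φᵀ p) T` over the successors `T` of `S`. Dual feasibility bounds each of these terms by
`Δc(T, r) + d(T, r)`, and complementary slackness turns the bound into an equality wherever step `r`
of `T` is used. If `S` is allocated in order and uses a step `≥ r`, then so does each successor `T`:
total quantities increase along paths, and `S` already fills all steps before `r`. If `T` leaves
step `r` itself unused, then `d(T, r) = 0`, and monotonicity of `Δc(T, ·)` between `r` and the used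
step again forces equality.
-/

theorem exists_nonneg_sum_insert_eq {ι R V : Type*} [DecidableEq ι] [Semiring R] [Preorder R]
    [AddCommMonoid V] [Module R V] {s : Finset ι} {k : ι} (hk : k ∉ s) (a : ι → V) {u : ι → R}
    {t : R} (hu : 0 ≤ u) (ht : 0 ≤ t) :
    ∃ u' : ι → R, 0 ≤ u' ∧ t • a k + ∑ j ∈ s, u j • a j = ∑ j ∈ insert k s, u' j • a j := by
  refine ⟨Function.update u k t, le_update_iff.2 ⟨ht, fun j _ => hu j⟩, ?_⟩
  rw [sum_insert hk, Function.update_self]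
  congr 1
  exact sum_congr rfl fun j hj => by rw [Function.update_of_ne (ne_of_mem_of_not_mem hj hk)]

open scoped Matrix

variable {ι κ 𝕜 V : Type*} [Field 𝕜] [LinearOrder 𝕜] [IsStrictOrderedRing 𝕜]

section Functionals

variable [AddCommGroup V] [Module 𝕜 V]

/-- If `c ≤ 0` already follows from the constraints in `s`, the new functional gets weight `0`.
Otherwise some `w` satisfies these constraints but `c w > 0`, so that `a k w > 0`; projecting along
`w` onto the kernel of `a k` reduces the claim to `s`. -/
theorem farkas (s : Finset ι) (a : ι → Module.Dual 𝕜 V) (c : Module.Dual 𝕜 V)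
    (h : ∀ z, (∀ j ∈ s, a j z ≤ 0) → c z ≤ 0) :
    ∃ u : ι → 𝕜, 0 ≤ u ∧ c = ∑ j ∈ s, u j • a j := by
  classical
  induction s using Finset.induction_on generalizing a c with
  | empty =>
    refine ⟨0, le_rfl, LinearMap.ext fun z => le_antisymm (h z (by simp)) ?_⟩
    simpa using h (-z) (by simp)
  | insert k s hk ih =>
    by_cases hc : ∀ z, (∀ j ∈ s, a j z ≤ 0) → c z ≤ 0
    · obtain ⟨u, hu, rfl⟩ := ih a c hc
      simpa using exists_nonneg_sum_insert_eq hk a hu le_rfl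
    · push Not at hc
      obtain ⟨w₀, hw₀s, hcw₀⟩ := hc
      have hkw₀ : 0 < a k w₀ := by
        contrapose! hcw₀
        exact h w₀ ((forall_mem_insert k s _).2 ⟨hcw₀, hw₀s⟩)
      obtain ⟨w, hws, hcw, hkw⟩ : ∃ w, (∀ j ∈ s, a j w ≤ 0) ∧ 0 < c w ∧ a k w = 1 := by
        refine ⟨(a k w₀)⁻¹ • w₀, fun j hj => ?_, ?_, by simp [hkw₀.ne']⟩
        · simpa using mul_nonpos_of_nonneg_of_nonpos (inv_nonneg.2 hkw₀.le) (hw₀s j hj)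
        · simpa using mul_pos (inv_pos.2 hkw₀) hcw₀
      obtain ⟨u, hu, hcu⟩ := ih (fun j => a j - a j w • a k) (c - c w • a k) fun z hz => by
        have := h (z - a k z • w) <| (forall_mem_insert k s _).2
          ⟨by simp [hkw], fun j hj => by simpa [mul_comm] using hz j hj⟩
        simpa [mul_comm] using this
      have hnonneg : 0 ≤ c w - ∑ j ∈ s, u j * a j w := sub_nonneg.2 <|
        (sum_nonpos fun j hj => mul_nonpos_of_nonneg_of_nonpos (hu j) (hws j hj)).trans hcw.le
      have hc_eq : c = (c w - ∑ j ∈ s, u j * a j w) • a k + ∑ j ∈ s, u j • a j := calc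
        c = ∑ j ∈ s, u j • (a j - a j w • a k) + c w • a k := sub_eq_iff_eq_add.1 hcu
        _ = _ := by
          simp only [smul_sub, smul_smul, sum_sub_distrib, sub_smul _ _ (a k), ← sum_smul]
          abel
      simpa only [← hc_eq] using exists_nonneg_sum_insert_eq hk a hu hnonneg

theorem exists_pos_forall_add_smul_le [Finite ι] {a : ι → Module.Dual 𝕜 V} {β : ι → 𝕜} {z w : V}
    (hz : ∀ j, a j z ≤ β j) (hw : ∀ j, a j z = β j → a j w ≤ 0) :
    ∃ t : 𝕜, 0 < t ∧ ∀ j, a j (z + t • w) ≤ β j := by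
  have hstep (j : ι) : ∃ ε : Set.Ioi (0 : 𝕜), ∀ t : 𝕜, 0 < t → t ≤ ε → a j (z + t • w) ≤ β j := by
    simp only [map_add, map_smul, smul_eq_mul]
    rcases le_or_gt (a j w) 0 with hle | hpos
    · exact ⟨⟨1, one_pos⟩, fun t ht _ =>
        (add_le_of_nonpos_right (mul_nonpos_of_nonneg_of_nonpos ht.le hle)).trans (hz j)⟩
    · have hlt : a j z < β j := (hz j).lt_of_ne fun hj => hpos.not_ge (hw j hj)
      refine ⟨⟨(β j - a j z) / a j w, div_pos (sub_pos.2 hlt) hpos⟩, fun t _ ht => ?_⟩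
      rw [← le_sub_iff_add_le']
      exact (le_div_iff₀ hpos).1 ht
  choose ε hε using hstep
  obtain ⟨⟨t, ht⟩, htε⟩ := Finite.bddBelow_range ε
  exact ⟨t, ht, fun j => hε j t ht (htε (Set.mem_range_self j))⟩

theorem exists_multipliers_of_isMaxOn [Fintype ι] {a : ι → Module.Dual 𝕜 V} {β : ι → 𝕜}
    {c : Module.Dual 𝕜 V} {z : V} (hz : ∀ j, a j z ≤ β j)
    (hmax : IsMaxOn c {w | ∀ j, a j w ≤ β j} z) :
    ∃ u : ι → 𝕜, 0 ≤ u ∧ c = ∑ j, u j • a j ∧ c z = ∑ j, u j * β j := by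
  classical
  obtain ⟨u, hu, rfl⟩ := farkas ({j | a j z = β j} : Finset ι) a c fun w hw => by
    obtain ⟨t, ht, hfeas⟩ := exists_pos_forall_add_smul_le (w := w) hz
      fun j hj => hw j (by simpa using hj)
    have : c (z + t • w) ≤ c z := hmax hfeas
    rw [map_add, map_smul, add_le_iff_nonpos_right] at this
    exact nonpos_of_mul_nonpos_right this ht
  refine ⟨fun j => if a j z = β j then u j else 0, fun j => ?_, ?_, ?_⟩
  · dsimp only
    split_ifs
    exacts [hu j, le_rfl]
  · simp only [sum_filter, ite_smul, zero_smul]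
  · simp only [LinearMap.sum_apply, sum_filter, ite_mul, zero_mul]
    refine sum_congr rfl fun j _ => ?_
    split_ifs with hj
    exacts [congrArg (u j * ·) hj, rfl]

end Functionals

variable [Fintype ι] [Fintype κ]

/-- The feasible points of the linear program `max c ⬝ᵥ z` subject to `A *ᵥ z ≤ β` and `0 ≤ z`. -/
def primalPolyhedron (A : Matrix ι κ 𝕜) (β : ι → 𝕜) : Set (κ → 𝕜) :=
  {z | 0 ≤ z ∧ A *ᵥ z ≤ β}

/-- The feasible points of the dual program `min u ⬝ᵥ β` subject to `c ≤ u ᵥ* A` and `0 ≤ u`. -/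
def dualPolyhedron (A : Matrix ι κ 𝕜) (c : κ → 𝕜) : Set (ι → 𝕜) :=
  {u | 0 ≤ u ∧ c ≤ u ᵥ* A}

theorem exists_mem_dualPolyhedron_of_isMaxOn {A : Matrix ι κ 𝕜} {β : ι → 𝕜} {c z : κ → 𝕜}
    (hz : z ∈ primalPolyhedron A β) (hmax : IsMaxOn (c ⬝ᵥ ·) (primalPolyhedron A β) z) :
    ∃ u ∈ dualPolyhedron A c, u ⬝ᵥ β = c ⬝ᵥ z := by
  classical
  let a : ι ⊕ κ → Module.Dual 𝕜 (κ → 𝕜) :=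
    Sum.elim (fun j => LinearMap.proj j ∘ₗ A.mulVecLin) fun i => -LinearMap.proj i
  have mem_iff (w : κ → 𝕜) : (∀ j, a j w ≤ Sum.elim β 0 j) ↔ w ∈ primalPolyhedron A β := by
    simp [a, primalPolyhedron, Pi.le_def, and_comm]
  obtain ⟨u, hu, hcu, hval⟩ := exists_multipliers_of_isMaxOn (c := dotProductBilin 𝕜 𝕜 c)
    ((mem_iff z).2 hz) fun w hw => hmax ((mem_iff w).1 hw)
  refine ⟨u ∘ Sum.inl, ⟨fun j => hu _, fun i => ?_⟩, ?_⟩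
  · have hi : c i = ((u ∘ Sum.inl) ᵥ* A) i - u (.inr i) := by
      simpa [a, Matrix.vecMul, dotProduct, Pi.single_apply, ← sub_eq_add_neg] using
        LinearMap.congr_fun hcu (Pi.single i 1)
    exact hi.trans_le (sub_le_self _ (hu (.inr i)))
  · simpa [dotProduct] using hval.symm

theorem complementary_slackness {A : Matrix ι κ 𝕜} {β u : ι → 𝕜} {c z : κ → 𝕜}
    (hz : z ∈ primalPolyhedron A β) (hmax : IsMaxOn (c ⬝ᵥ ·) (primalPolyhedron A β) z)
    (hu : u ∈ dualPolyhedron A c) (hmin : IsMinOn (· ⬝ᵥ β) (dualPolyhedron A c) u) :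
    (∀ j, u j * (β j - (A *ᵥ z) j) = 0) ∧ ∀ i, ((u ᵥ* A) i - c i) * z i = 0 := by
  obtain ⟨u', hu', hval⟩ := exists_mem_dualPolyhedron_of_isMaxOn hz hmax
  have hgap : u ⬝ᵥ (β - A *ᵥ z) + (u ᵥ* A - c) ⬝ᵥ z ≤ 0 := by
    have : u ⬝ᵥ β ≤ u' ⬝ᵥ β := hmin hu'
    rw [dotProduct_sub, sub_dotProduct, Matrix.dotProduct_mulVec]
    linarith
  have hprimal (j) : 0 ≤ u j * (β j - (A *ᵥ z) j) := mul_nonneg (hu.1 j) (sub_nonneg.2 (hz.2 j))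
  have hdual (i) : 0 ≤ ((u ᵥ* A) i - c i) * z i := mul_nonneg (sub_nonneg.2 (hu.2 i)) (hz.1 i)
  have hprimal_sum : 0 ≤ u ⬝ᵥ (β - A *ᵥ z) := Fintype.sum_nonneg hprimal
  have hdual_sum : 0 ≤ (u ᵥ* A - c) ⬝ᵥ z := Fintype.sum_nonneg hdual
  exact ⟨congr_fun ((Fintype.sum_eq_zero_iff_of_nonneg hprimal).1 (by
      change u ⬝ᵥ (β - A *ᵥ z) = 0; linarith)),
    congr_fun ((Fintype.sum_eq_zero_iff_of_nonneg hdual).1 (by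
      change (u ᵥ* A - c) ⬝ᵥ z = 0; linarith))⟩

end LinearProgramming

namespace CostFunctionGraph

open scoped Matrix

variable {n : ℕ} (G : CostFunctionGraph n)

theorem mem_predecessors {S T : Package n} : T ∈ G.predecessors S ↔ G.Connected T S := by
  simp [predecessors]

theorem mem_successors {S T : Package n} : T ∈ G.successors S ↔ G.Connected S T := by
  simp [successors]

open Classical in
/-- The zeta matrix of the reachability order of the graph. It sums a function over predecessors,
its transpose sums over successors, and the matrix of the characteristic function is its inverse. -/
noncomputable def zetaMatrix : Matrix (Package n) (Package n) ℝ :=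
  Matrix.of fun S T => if G.Connected T S then 1 else 0

theorem zetaMatrix_mulVec (f : Package n → ℝ) (S : Package n) :
    (G.zetaMatrix *ᵥ f) S = ∑ T ∈ G.predecessors S, f T := by
  simp [zetaMatrix, predecessors, Matrix.mulVec, dotProduct, sum_filter]

theorem transpose_zetaMatrix_mulVec (f : Package n → ℝ) (S : Package n) :
    (G.zetaMatrixᵀ *ᵥ f) S = ∑ T ∈ G.successors S, f T := by
  simp [zetaMatrix, successors, Matrix.mulVec, dotProduct, sum_filter]

theorem predecessors_eq_cons (S : Package n) :
    G.predecessors S = cons S (G.strictPredecessors S) (by simp [strictPredecessors]) := by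
  ext T
  by_cases hT : T = S
  · have hS : G.Connected S S := Relation.ReflTransGen.refl
    simp [hT, mem_predecessors, hS]
  · simp [predecessors, strictPredecessors, hT]

theorem sum_predecessors_charFun (Y : Package n → ℝ) (S : Package n) :
    ∑ T ∈ G.predecessors S, G.charFun Y T = Y S := by
  rw [predecessors_eq_cons, sum_cons, charFun_eq G Y S, sub_add_cancel]

theorem zetaMatrix_mul_charMatrix : G.zetaMatrix * G.charMatrix = 1 := by
  refine Matrix.ext_of_mulVec_single fun T => funext fun S => ?_
  rw [← Matrix.mulVec_mulVec, ← charFun_eq_mulVec, zetaMatrix_mulVec, sum_predecessors_charFun,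
    Matrix.one_mulVec]

theorem charDual_apply (p : Package n → ℝ) (S : Package n) :
    G.charDual p S = ∑ T, p T * G.charMatrix T S := by
  simp [charDual, Matrix.mulVec_transpose, Matrix.vecMul, dotProduct]

theorem sum_successors_charDual (p : Package n → ℝ) (S : Package n) :
    ∑ T ∈ G.successors S, G.charDual p T = p S := by
  rw [← transpose_zetaMatrix_mulVec, charDual, Matrix.mulVec_mulVec, ← Matrix.transpose_mul,
    mul_eq_one_comm.1 G.zetaMatrix_mul_charMatrix, Matrix.transpose_one, Matrix.one_mulVec]

theorem predecessors_subset_of_connected {S T : Package n} (h : G.Connected S T) :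
    G.predecessors S ⊆ G.predecessors T := fun _ hU =>
  G.mem_predecessors.2 (Relation.ReflTransGen.trans (G.mem_predecessors.1 hU) h)

theorem le_of_connected_of_charFun_nonneg {Y : Package n → ℝ} (hY : 0 ≤ G.charFun Y)
    {S T : Package n} (h : G.Connected S T) : Y S ≤ Y T := by
  rw [← G.sum_predecessors_charFun Y S, ← G.sum_predecessors_charFun Y T]
  exact sum_le_sum_of_subset_of_nonneg (G.predecessors_subset_of_connected h) fun U _ _ => hY U

end CostFunctionGraph

section ExtendedReal

theorem ereal_coe_sum {ι : Type*} (s : Finset ι) (f : ι → ℝ) :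
    ((∑ i ∈ s, f i : ℝ) : EReal) = ∑ i ∈ s, (f i : EReal) :=
  map_sum (⟨⟨Real.toEReal, EReal.coe_zero⟩, EReal.coe_add⟩ : ℝ →+ EReal) f s

theorem ereal_sum_ne_bot {ι : Type*} {s : Finset ι} {f : ι → EReal} (h : ∀ i ∈ s, f i ≠ ⊥) :
    ∑ i ∈ s, f i ≠ ⊥ :=
  sum_induction f (· ≠ ⊥) (fun _ _ ha hb => EReal.add_ne_bot_iff.2 ⟨ha, hb⟩) EReal.zero_ne_bot h

theorem ereal_sum_eq_top {ι : Type*} {s : Finset ι} {f : ι → EReal} (h : ∀ i ∈ s, f i ≠ ⊥) {k : ι}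
    (hk : k ∈ s) (htop : f k = ⊤) : ∑ i ∈ s, f i = ⊤ := by
  classical
  rw [← add_sum_erase s f hk, htop]
  exact EReal.top_add_of_ne_bot (ereal_sum_ne_bot fun i hi => h i (mem_of_mem_erase hi))

theorem costToEReal_ne_bot (c : WithTop ℤ) : costToEReal c ≠ ⊥ := by
  cases c
  · exact top_ne_bot
  · exact EReal.coe_ne_bot _

theorem costToEReal_mono : Monotone costToEReal := by
  intro c c' h
  cases c' with
  | top => exact le_top
  | coe z' =>
    lift c to ℤ using ne_top_of_le_ne_top WithTop.coe_ne_top h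
    exact EReal.coe_le_coe_iff.2 (Int.cast_le.2 (WithTop.coe_le_coe.1 h))

end ExtendedReal

namespace Market

open scoped Matrix

variable {n L : ℕ} {M : Market n L}

theorem incCost_ne_bot (S : Package n) (r : ℕ) : M.incCost S r ≠ ⊥ :=
  costToEReal_ne_bot _

theorem incCost_le_incCost (S : Package n) {r r' : M.Step} (h : r ≤ r') :
    M.incCost S r ≤ M.incCost S r' :=
  costToEReal_mono <| monotoneOn_of_le_succ Set.ordConnected_Ici
    (fun r _ hr _ => M.Δc_mono S r hr) (mem_Icc.1 r.2).1 (mem_Icc.1 r'.2).1 h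

theorem coe_toReal_incCost {S : Package n} {r : ℕ} (h : M.incCost S r ≠ ⊤) :
    ((M.incCost S r).toReal : EReal) = M.incCost S r :=
  EReal.coe_toReal h (incCost_ne_bot S r)

theorem DualFeasible.charDual_le_incCost_add {b : M.Agent → Fin L → ℝ} {p : Package n → ℝ}
    {d : Package n → M.Step → ℝ} (h : M.DualFeasible b p d) (S : Package n) (r : M.Step) :
    (M.G.charDual p S : EReal) ≤ M.incCost S r + (d S r : EReal) := by
  by_cases htop : M.incCost S r = ⊤
  · simp [htop]
  · have := h.seller S r
    rw [← coe_toReal_incCost htop] at this ⊢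
    norm_cast at this ⊢
    linarith

variable (M) in
/-- The constraint matrix of the relaxation in the form `A *ᵥ z ≤ β`, `0 ≤ z`. Its rows are the
unit-demand agents, the packages (supply) and the steps (capacity); its columns are the variables
`x S q l` and `y S r`. -/
noncomputable def constraintMatrix :
    Matrix ((M.Agent × Fin L) ⊕ Package n ⊕ (Package n × M.Step))
      ((Package n × M.Agent × Fin L) ⊕ (Package n × M.Step)) ℝ :=
  .of fun
    | .inl i, .inl (_, i') => if i = i' then 1 else 0
    | .inl _, .inr _ => 0
    | .inr (.inl S), .inl (T, _) => if S = T then 1 else 0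
    | .inr (.inl S), .inr (T, _) => -M.G.charMatrix S T
    | .inr (.inr _), .inl _ => 0
    | .inr (.inr i), .inr i' => if i = i' then 1 else 0

variable (M) in
open Classical in
/-- The right-hand side of `constraintMatrix`. Steps of infinite cost have capacity `0`, so that
their cost may be replaced by a real number. -/
noncomputable def constraintBound : (M.Agent × Fin L) ⊕ Package n ⊕ (Package n × M.Step) → ℝ
  | .inl _ => 1
  | .inr (.inl _) => 0
  | .inr (.inr (S, r)) => if M.incCost S r = ⊤ then 0 else 1

variable (M) in
/-- The objective of the relaxation, where infinite costs are replaced by `(⊤ : EReal).toReal = 0`;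
see `constraintBound`. -/
noncomputable def objective : (Package n × M.Agent × Fin L) ⊕ (Package n × M.Step) → ℝ
  | .inl (S, q, l) => M.v l S q
  | .inr (S, r) => -(M.incCost S r).toReal

/-- A point `(x, y)` of the relaxation as a vector of the program with `constraintMatrix`. -/
def primalVector (x : Package n → M.Agent → Fin L → ℝ) (y : Package n → M.Step → ℝ) :
    (Package n × M.Agent × Fin L) ⊕ (Package n × M.Step) → ℝ
  | .inl (S, q, l) => x S q l
  | .inr (S, r) => y S r

/-- A point `(b, p, d)` of the dual as a vector of multipliers for `constraintMatrix`. -/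
def dualVector (b : M.Agent → Fin L → ℝ) (p : Package n → ℝ) (d : Package n → M.Step → ℝ) :
    (M.Agent × Fin L) ⊕ Package n ⊕ (Package n × M.Step) → ℝ
  | .inl (q, l) => b q l
  | .inr (.inl S) => p S
  | .inr (.inr (S, r)) => d S r

theorem exists_primalVector_eq (z : (Package n × M.Agent × Fin L) ⊕ (Package n × M.Step) → ℝ) :
    ∃ x y, primalVector x y = z :=
  ⟨fun S q l => z (.inl (S, q, l)), fun S r => z (.inr (S, r)), by ext (_ | _) <;> rfl⟩

theorem exists_dualVector_eq (u : (M.Agent × Fin L) ⊕ Package n ⊕ (Package n × M.Step) → ℝ) :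
    ∃ b p d, dualVector b p d = u :=
  ⟨fun q l => u (.inl (q, l)), fun S => u (.inr (.inl S)), fun S r => u (.inr (.inr (S, r))),
    by ext (_ | _ | _) <;> rfl⟩

section

variable {x : Package n → M.Agent → Fin L → ℝ} {y : Package n → M.Step → ℝ}
  {b : M.Agent → Fin L → ℝ} {p : Package n → ℝ} {d : Package n → M.Step → ℝ}

theorem constraintMatrix_mulVec_agent (q : M.Agent) (l : Fin L) :
    (M.constraintMatrix *ᵥ primalVector x y) (.inl (q, l)) = ∑ S, x S q l := by
  simp [constraintMatrix, primalVector, Matrix.mulVec, dotProduct, Fintype.sum_prod_type]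

theorem constraintMatrix_mulVec_supply (S : Package n) :
    (M.constraintMatrix *ᵥ primalVector x y) (.inr (.inl S)) =
      (∑ q : M.Agent, ∑ l, x S q l) - M.G.charFun (fun T => ∑ r : M.Step, y T r) S := by
  simp [constraintMatrix, primalVector, CostFunctionGraph.charFun_eq_mulVec, Matrix.mulVec,
    dotProduct, Fintype.sum_prod_type, mul_sum, sub_eq_add_neg]

theorem constraintMatrix_mulVec_step (S : Package n) (r : M.Step) :
    (M.constraintMatrix *ᵥ primalVector x y) (.inr (.inr (S, r))) = y S r := by
  simp [constraintMatrix, primalVector, Matrix.mulVec, dotProduct]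

theorem dualVector_vecMul_assignment (S : Package n) (q : M.Agent) (l : Fin L) :
    (dualVector b p d ᵥ* M.constraintMatrix) (.inl (S, q, l)) = b q l + p S := by
  simp [constraintMatrix, dualVector, Matrix.vecMul, dotProduct]

theorem dualVector_vecMul_step (S : Package n) (r : M.Step) :
    (dualVector b p d ᵥ* M.constraintMatrix) (.inr (S, r)) = d S r - M.G.charDual p S := by
  simp [constraintMatrix, dualVector, CostFunctionGraph.charDual_apply, Matrix.vecMul, dotProduct,
    sub_eq_neg_add]

theorem primalVector_mem_primalPolyhedron :
    primalVector x y ∈ primalPolyhedron M.constraintMatrix M.constraintBound ↔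
      M.PrimalFeasible x y ∧ ∀ S (r : M.Step), M.incCost S r = ⊤ → y S r = 0 := by
  simp only [primalPolyhedron, Set.mem_ofPred_eq, Pi.le_def, Sum.forall, Prod.forall,
    constraintMatrix_mulVec_agent, constraintMatrix_mulVec_supply, constraintMatrix_mulVec_step,
    primalVector, constraintBound, Pi.zero_apply]
  constructor
  · rintro ⟨⟨hx, hy⟩, hagent, hsupply, hstep⟩
    refine ⟨⟨hagent, hsupply, fun S r => (hstep S r).trans ?_, hx, hy⟩, fun S r htop => ?_⟩
    · split_ifs <;> norm_num
    · exact le_antisymm (by simpa [htop] using hstep S r) (hy S r)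
  · rintro ⟨⟨hagent, hsupply, hstep, hx, hy⟩, hzero⟩
    refine ⟨⟨hx, hy⟩, hagent, hsupply, fun S r => ?_⟩
    split_ifs with htop
    exacts [(hzero S r htop).le, hstep S r]

theorem primalValue_eq_dotProduct (hy : ∀ S (r : M.Step), M.incCost S r = ⊤ → y S r = 0) :
    M.primalValue x y = (M.objective ⬝ᵥ primalVector x y : ℝ) := by
  have hcost (S) (r : M.Step) :
      M.incCost S r * (y S r : EReal) = ((M.incCost S r).toReal * y S r : ℝ) := by
    by_cases htop : M.incCost S r = ⊤
    · simp [hy S r htop]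
    · rw [EReal.coe_mul, coe_toReal_incCost htop]
  simp only [primalValue, hcost, ← ereal_coe_sum, ← EReal.coe_sub]
  simp [objective, primalVector, dotProduct, Fintype.sum_prod_type, sub_eq_add_neg]

theorem primalFeasible_zero : M.PrimalFeasible 0 0 := by
  refine ⟨?_, ?_, ?_, ?_, ?_⟩ <;> simp [CostFunctionGraph.charFun_eq_mulVec, ← Pi.zero_def]

theorem primalValue_eq_bot (hy : ∀ S r, 0 ≤ y S r) {S : Package n} {r : M.Step}
    (htop : M.incCost S r = ⊤) (hpos : 0 < y S r) : M.primalValue x y = ⊥ := by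
  have hne_bot (T) (t : M.Step) : M.incCost T t * (y T t : EReal) ≠ ⊥ := by
    by_cases h : M.incCost T t = ⊤
    · rcases (hy T t).eq_or_lt with h0 | h0
      · simp [← h0]
      · simp [h, EReal.top_mul_coe_of_pos h0]
    · rw [← coe_toReal_incCost h, ← EReal.coe_mul]
      exact EReal.coe_ne_bot _
  rw [primalValue, ereal_sum_eq_top (fun T _ => ereal_sum_ne_bot fun t _ => hne_bot T t)
    (mem_univ S) (ereal_sum_eq_top (fun t _ => hne_bot S t) (mem_univ r) ?_), EReal.sub_top]
  rw [htop, EReal.top_mul_coe_of_pos hpos]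

theorem PrimalOptimal.eq_zero_of_incCost_eq_top (hxy : M.PrimalOptimal x y) (S : Package n)
    (r : M.Step) (htop : M.incCost S r = ⊤) : y S r = 0 := by
  by_contra hne
  have hbot : M.primalValue x y = ⊥ := primalValue_eq_bot hxy.feasible.y_nonneg htop
    ((hxy.feasible.y_nonneg S r).lt_of_ne' hne)
  have hle := hxy.optimal 0 0 primalFeasible_zero
  rw [hbot, primalValue_eq_dotProduct (y := 0) fun _ _ _ => rfl, le_bot_iff] at hle
  exact EReal.coe_ne_bot _ hle

theorem PrimalOptimal.isMaxOn (hxy : M.PrimalOptimal x y) :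
    IsMaxOn (M.objective ⬝ᵥ ·) (primalPolyhedron M.constraintMatrix M.constraintBound)
      (primalVector x y) := by
  intro z hz
  obtain ⟨x', y', rfl⟩ := exists_primalVector_eq z
  obtain ⟨hfeas, hzero⟩ := primalVector_mem_primalPolyhedron.1 hz
  have := hxy.optimal x' y' hfeas
  rwa [primalValue_eq_dotProduct hzero, primalValue_eq_dotProduct hxy.eq_zero_of_incCost_eq_top,
    EReal.coe_le_coe_iff] at this

open Classical in
theorem dualVector_dotProduct_constraintBound :
    dualVector b p d ⬝ᵥ M.constraintBound =
      M.dualValue b fun S r => if M.incCost S r = ⊤ then 0 else d S r := by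
  simp [dualValue, dualVector, constraintBound, dotProduct, Fintype.sum_prod_type]

theorem dualVector_mem_dualPolyhedron :
    dualVector b p d ∈ dualPolyhedron M.constraintMatrix M.objective ↔
      ((∀ q l, 0 ≤ b q l) ∧ (∀ S, 0 ≤ p S) ∧ ∀ S r, 0 ≤ d S r) ∧
      (∀ S (q : M.Agent) l, (M.v l S q : ℝ) ≤ b q l + p S) ∧
      ∀ S (r : M.Step), -(M.incCost S r).toReal ≤ d S r - M.G.charDual p S := by
  simp only [dualPolyhedron, Set.mem_ofPred_eq, Pi.le_def, Sum.forall, Prod.forall,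
    dualVector_vecMul_assignment, dualVector_vecMul_step, dualVector, objective, Pi.zero_apply]

theorem neg_incCost_le_coe_iff {S : Package n} {r : ℕ} (h : M.incCost S r ≠ ⊤) {t : ℝ} :
    -M.incCost S r ≤ t ↔ -(M.incCost S r).toReal ≤ t := by
  rw [← coe_toReal_incCost h, EReal.toReal_coe]
  norm_cast

open Classical in
/-- A step of infinite cost does not constrain the dual and has capacity `0`, so its multiplier may
be chosen as large as the constraint of the real program requires. -/
theorem DualFeasible.dualVector_mem_dualPolyhedron (h : M.DualFeasible b p d) :
    dualVector b p (fun S (r : M.Step) => if M.incCost S r = ⊤ then |M.G.charDual p S| else d S r) ∈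
      dualPolyhedron M.constraintMatrix M.objective := by
  refine Market.dualVector_mem_dualPolyhedron.2
    ⟨⟨h.b_nonneg, h.p_nonneg, fun S r => ?_⟩, h.buyer, fun S r => ?_⟩
  · split_ifs
    exacts [abs_nonneg _, h.d_nonneg S r]
  · split_ifs with htop
    · simpa [htop] using le_abs_self (M.G.charDual p S)
    · exact (neg_incCost_le_coe_iff htop).1 (h.seller S r)

open Classical in
theorem dualFeasible_of_mem_dualPolyhedron
    (h : dualVector b p d ∈ dualPolyhedron M.constraintMatrix M.objective) :
    M.DualFeasible b p fun S r => if M.incCost S r = ⊤ then 0 else d S r := by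
  obtain ⟨⟨hb, hp, hd⟩, hbuyer, hseller⟩ := dualVector_mem_dualPolyhedron.1 h
  refine ⟨hbuyer, fun S r => ?_, hb, fun S r => ?_, hp⟩
  · split_ifs with htop
    · simp [htop]
    · exact (neg_incCost_le_coe_iff htop).2 (hseller S r)
  · split_ifs
    exacts [le_rfl, hd S r]

open Classical in
theorem DualOptimal.isMinOn (hbpd : M.DualOptimal b p d) :
    IsMinOn (· ⬝ᵥ M.constraintBound) (dualPolyhedron M.constraintMatrix M.objective)
      (dualVector b p fun S (r : M.Step) =>
        if M.incCost S r = ⊤ then |M.G.charDual p S| else d S r) := by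
  intro u hu
  obtain ⟨b', p', d', rfl⟩ := exists_dualVector_eq u
  simp only [Set.mem_ofPred_eq, dualVector_dotProduct_constraintBound]
  refine le_trans ?_ (hbpd.optimal _ _ _ (dualFeasible_of_mem_dualPolyhedron hu))
  unfold dualValue
  gcongr with S _ r _
  dsimp only
  split_ifs
  exacts [hbpd.feasible.d_nonneg S r, le_rfl]

theorem PrimalOptimal.step_slackness (hxy : M.PrimalOptimal x y) (hbpd : M.DualOptimal b p d)
    {S : Package n} {r : M.Step} (hfin : M.incCost S r ≠ ⊤) :
    d S r * (1 - y S r) = 0 ∧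
      (d S r - M.G.charDual p S + (M.incCost S r).toReal) * y S r = 0 := by
  classical
  obtain ⟨hcapacity, hseller⟩ := complementary_slackness
    (primalVector_mem_primalPolyhedron.2 ⟨hxy.feasible, hxy.eq_zero_of_incCost_eq_top⟩)
    hxy.isMaxOn hbpd.feasible.dualVector_mem_dualPolyhedron hbpd.isMinOn
  constructor
  · simpa [constraintMatrix_mulVec_step, dualVector, constraintBound, hfin] using
      hcapacity (.inr (.inr (S, r)))
  · simpa [dualVector_vecMul_step, objective, primalVector, hfin] using hseller (.inr (S, r))

theorem PrimalOptimal.incCost_add_eq_charDual (hxy : M.PrimalOptimal x y)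
    (hbpd : M.DualOptimal b p d) {S : Package n} {r : M.Step} (hpos : 0 < y S r) :
    M.incCost S r + (d S r : EReal) = (M.G.charDual p S : EReal) := by
  have hfin : M.incCost S r ≠ ⊤ := fun htop => hpos.ne' (hxy.eq_zero_of_incCost_eq_top S r htop)
  have := (mul_eq_zero.1 (hxy.step_slackness hbpd hfin).2).resolve_right hpos.ne'
  rw [← coe_toReal_incCost hfin, ← EReal.coe_add, EReal.coe_eq_coe_iff]
  linarith

/-- If step `r` is itself unused, its slack variable vanishes, and its cost is at most that of the
used step `r'`. -/
theorem PrimalOptimal.incCost_add_eq_charDual_of_le (hxy : M.PrimalOptimal x y)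
    (hbpd : M.DualOptimal b p d) {S : Package n} {r r' : M.Step} (hr : r ≤ r')
    (hpos : 0 < y S r') : M.incCost S r + (d S r : EReal) = (M.G.charDual p S : EReal) := by
  rcases (hxy.feasible.y_nonneg S r).eq_or_lt with hzero | hpos_r
  · have htight := hxy.incCost_add_eq_charDual hbpd hpos
    have hcost := incCost_le_incCost S hr
    have hfin : M.incCost S r ≠ ⊤ := ne_top_of_le_ne_top
      (fun htop => hpos.ne' (hxy.eq_zero_of_incCost_eq_top S r' htop)) hcost
    have hd : d S r = 0 := by simpa [← hzero] using (hxy.step_slackness hbpd hfin).1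
    refine le_antisymm ?_ (hbpd.feasible.charDual_le_incCost_add S r)
    rw [← htight, hd]
    gcongr
    exact hbpd.feasible.d_nonneg S r'
  · exact hxy.incCost_add_eq_charDual hbpd hpos_r

theorem PrimalFeasible.sum_steps_le_of_connected (h : M.PrimalFeasible x y) {S T : Package n}
    (hST : M.G.Connected S T) : ∑ r, y S r ≤ ∑ r, y T r :=
  M.G.le_of_connected_of_charFun_nonneg (Y := fun T => ∑ r : M.Step, y T r)
    (fun U => (sum_nonneg fun q _ => sum_nonneg fun l _ => h.x_nonneg U q l).trans
      (sub_nonpos.1 (h.supply U))) hST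

theorem exists_le_pos_of_le_lastStep {S : Package n} {r : M.Step}
    (hr : (r : ℕ) ≤ M.lastStep y S) : ∃ r', r ≤ r' ∧ 0 < y S r' := by
  obtain ⟨r', hr', hle⟩ := (Finset.le_sup_iff (bot_lt_iff_ne_bot.2
    (Nat.one_le_iff_ne_zero.1 (mem_Icc.1 r.2).1))).1 hr
  exact ⟨r', hle, (mem_filter.1 hr').2⟩

/-- Otherwise `T` would receive at most as much as `S` on every step, and less on one of them,
although the total quantities of successors are at least as large. -/
theorem PrimalFeasible.exists_le_pos_of_connected (h : M.PrimalFeasible x y) {S T : Package n}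
    (hST : M.G.Connected S T) (hS : M.AllocatedInOrder y S) {r : M.Step}
    (hr : (r : ℕ) ≤ M.lastStep y S) : ∃ r', r ≤ r' ∧ 0 < y T r' := by
  obtain ⟨t, hrt, hpos⟩ := exists_le_pos_of_le_lastStep hr
  by_contra! hT
  refine (h.sum_steps_le_of_connected hST).not_gt
    (sum_lt_sum (fun s _ => ?_) ⟨t, mem_univ t, (hT t hrt).trans_lt hpos⟩)
  rcases lt_or_ge s r with hsr | hrs
  · exact (h.y_le_one T s).trans_eq (hS s t (hsr.trans_le hrt) hpos).symm
  · exact (hT s hrs).trans (h.y_nonneg S s)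

theorem DualFeasible.price_le (h : M.DualFeasible b p d) (r : M.Step) (S : Package n) :
    (p S : EReal) ≤ (∑ T ∈ M.G.successors S, M.incCost T r) +
      ((∑ T ∈ M.G.successors S, d T r : ℝ) : EReal) := by
  rw [← M.G.sum_successors_charDual p S, ereal_coe_sum, ereal_coe_sum, ← sum_add_distrib]
  exact sum_le_sum fun T _ => h.charDual_le_incCost_add T r

theorem PrimalOptimal.price_eq (hxy : M.PrimalOptimal x y) (hbpd : M.DualOptimal b p d)
    {S : Package n} (hS : M.AllocatedInOrder y S) {r : M.Step}
    (hr : (r : ℕ) ≤ M.lastStep y S) :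
    (p S : EReal) = (∑ T ∈ M.G.successors S, M.incCost T r) +
      ((∑ T ∈ M.G.successors S, d T r : ℝ) : EReal) := by
  rw [← M.G.sum_successors_charDual p S, ereal_coe_sum, ereal_coe_sum, ← sum_add_distrib]
  refine sum_congr rfl fun T hT => ?_
  obtain ⟨r', hrr', hpos⟩ :=
    hxy.feasible.exists_le_pos_of_connected (M.G.mem_successors.1 hT) hS hr
  exact (hxy.incCost_add_eq_charDual_of_le hbpd hrr' hpos).symm

end

end Market

section Pricing

variable {n L : ℕ} (p : Package n → ℝ)

theorem priceOf_add (a : Fin (L + 1)) (k k' : PackageMultiset n) :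
    priceOf L p a (k + k') = priceOf L p a k + priceOf L p a k' := by
  simp [priceOf, add_mul, sum_add_distrib]

theorem priceOf_singlePackage (a : Fin (L + 1)) (S : Package n) :
    priceOf L p a (singlePackage S) = p S := by
  simp [priceOf, singlePackage, Pi.single_apply]

theorem isUniform_priceOf : IsUniform (priceOf L p) := fun a S k k' => by
  simp only [priceOf_add, add_sub_cancel_left]

theorem isAnonymous_priceOf : IsAnonymous (priceOf L p) := fun _ _ _ => rfl

theorem isPackageLinear_priceOf : IsPackageLinear (priceOf L p) := fun a k => by
  simp only [priceOf_singlePackage]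
  rfl

end Pricing

theorem mainTheorem5 {n L : ℕ} (M : Market n L)
    (x : Package n → M.Agent → Fin L → ℝ) (y : Package n → M.Step → ℝ)
    (hxy : M.PrimalOptimal x y)
    (b : M.Agent → Fin L → ℝ) (p : Package n → ℝ) (d : Package n → M.Step → ℝ)
    (hbpd : M.DualOptimal b p d) :
    (∀ (r : M.Step) (S : Package n),
      ((p S : ℝ) : EReal) ≤ (∑ S' ∈ M.G.successors S, M.incCost S' r)
        + ((∑ S' ∈ M.G.successors S, d S' r : ℝ) : EReal)) ∧
    (∀ S : Package n, M.AllocatedInOrder y S →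
      ∀ r : M.Step, (r : ℕ) ≤ M.lastStep y S →
        ((p S : ℝ) : EReal) = (∑ S' ∈ M.G.successors S, M.incCost S' r)
          + ((∑ S' ∈ M.G.successors S, d S' r : ℝ) : EReal)) ∧
    IsUniform (priceOf L p) ∧ IsAnonymous (priceOf L p) ∧ IsPackageLinear (priceOf L p) :=
  ⟨hbpd.feasible.price_le, fun _ hS _ hr => hxy.price_eq hbpd hS hr,
    isUniform_priceOf p, isAnonymous_priceOf p, isPackageLinear_priceOf p⟩
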